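/- **Setting.** Let $\mathbb T=\mathbb R/2\pi\mathbb Z$, with $L^2(\mathbb T)$ normed by the normalised measure, let $\hat v(k)$ be the Fourier coefficients of $v$, let $\gamma\in(0,1]$, and let $H^\gamma(\mathbb T)$ be the space of complex-valued $v\in L^2(\mathbb T)$ with $\|v\|_{H^\gamma}^2=\sum_k(1+k^2)^\gamma|\hat v(k)|^2<\infty$. Consider a dispersive equation $$\partial_t u+i\mathcal L u=\mathcal N(u),\qquad \widehat{\mathcal Lu}(k)=\omega(k)\hat u(k),\quad \omega:\mathbb Z\to\mathbb R,\qquad \mathcal N(u)=\sum_{j} m_j(D)\bigl(u^{a_j}\bar u^{\,b_j}\bigr),$$ where the sum is finite, $a_j,b_j\in\mathbb N$, and $m_j(D)$ is the Fourier multiplier with symbol $m_j:\mathbb Z\to\mathbb C$. Put $\mathcal U(t)=e^{-it\mathcal L}$. A solution on $[0,T]$ is a $u\in C([0,T];H^\gamma(\mathbb T))$ with $u(t)=\mathcal U(t)u(0)+\int_0^t\mathcal U(t-\sigma)\mathcal N(u(\sigma))\,d\sigma$ in every Fourier mode, where the monomials $u^{a_j}\bar u^{\,b_j}$ are integrable on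 $\mathbb T$ for a.e. $t$ and the Fourier coefficients of $\mathcal N(u(t))$ are integrable in $t$. A base low-regularity integrator is a map $\mathcal I_{LRI}(\cdot,\tau):H^\gamma\to H^\gamma$ for each step size $\tau$; its step is $\mathcal H_{phys}(v)=\mathcal U(\tau)v+\mathcal I_{LRI}(v,\tau)$. If $w$ is a solution on $[0,\tau]$ with $w(0)=v$, the defect at $v$ is $\mathcal E_{defect}(v,\tau)=\mathcal I_{exact}(v,\tau)-\mathcal I_{LRI}(v,\tau)$ with $\mathcal I_{exact}(v,\tau)=\int_0^\tau\mathcal U(\tau-\sigma)\mathcal N(w(\sigma))\,d\sigma=w(\tau)-\mathcal U(\tau)v$. The neural correction is $\mathcal H_{neural}=\mathbf P\circ\mathcal G_\theta\circ\mathbf R$. Here $\mathbf R=\Phi^*$ acts on the vector of the $N$ Fourier coefficients $\hat v(k)$, $-\lfloor N/2\rfloor\le k<\lceil N/2\rceil$, with a matrix $\Phi\in\mathbb C^{N\times K}$; $\mathbf P=\Phi$ maps back to trigonometric polynomials in these modes; and $\mathcal G_\theta:\mathbb C^K\to\mathbb C^K$ is a feed-forward network whose layers are $z\mapsto\sigma_l(\mathbf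 W^{(l)}z+b^{(l)})$, with scalar activations $\sigma_l$ applied componentwise. Put $L_{\theta,K}=\prod_l\|\mathbf W^{(l)}\|_2$. The HIN-LRI iterates are $u^0_{HIN}=u(0)$, $u^{n+1}_{HIN}=\mathcal H_{phys}(u^n_{HIN})+\tau\,\mathcal H_{neural}(u^n_{HIN})$. **Assumptions**, for $T>0$ and constants $R$, $C_0,C_D\ge0$, $\Lambda$, $\rho,\tau_1>0$, and for a step size $\tau$: 1. $\mathcal K\subset H^\gamma(\mathbb T)$ is compact, $\|v\|_{H^\gamma}\le R$ on $\mathcal K$, and the exact solution $u$ on $[0,T]$ under consideration has $u(t)\in\mathcal K$ for all $t\in[0,T]$. 2. The activations of $\mathcal G_\theta$ are Lipschitz with a constant $\kappa$, and $\kappa^{\mathrm{depth}}L_{\theta,K}\le\Lambda$. 3. $\Phi^*\Phi=I_K$. 4. $\varepsilon_{net}\in[0,1]$, $\delta\ge0$, and for all $v\in\mathcal K$ (and all solutions on $[0,\tau]$ starting at $v$) $$\|\tau\mathcal H_{neural}(v)-\mathcal E_{defect}(v,\tau)\|_{L^2}\le(\varepsilon_{net}+\delta)\,C_D\,\tau^{1+\gamma}\ln(1/\tau)\,\|v\|_{H^\gamma}^3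 .$$ 5. The base integrator converges: there is $A$ such that $\|w(n\tau')-\mathcal H_{phys}^n(w(0))\|_{L^2}\le A\tau'^{\gamma}$ for all $\tau'\in(0,\tau_1]$ (with $\mathcal H_{phys}$ taken at step size $\tau'$), $n\tau'\le T$, and all solutions $w$ on $[0,T]$ with values in $\mathcal K$. It is also Lipschitz-stable near $\mathcal K$: $\|\mathcal H_{phys}(v)-\mathcal H_{phys}(w)\|_{L^2}\le(1+C_0\tau')\|v-w\|_{L^2}$ for all $\tau'\in(0,\tau_1]$, $v\in\mathcal K$, $w\in H^\gamma$ with $\|v-w\|_{L^2}\le\rho$. **Theorem (Main Convergence Theorem).** For all $\gamma\in(0,1]$, $T>0$, $R$, $C_0,C_D\ge0$, $\Lambda$ there is a constant $C>0$, and for all $\rho,\tau_1>0$ and $B$ there is $\tau_0>0$, such that the following holds for every equation, every base integrator, every $\mathcal K$ and every solution $u$ on $[0,T]$ with mean-zero data $\int_{\mathbb T}u(0)\,dx=0$, all $\varepsilon_{net},\delta$ with $\varepsilon_{net}+\delta\le B$, every $\tau\in(0,\tau_0]$, and all $N,K$, $\Phi$ and $\mathcal G_\theta$ (which may depend on $\tau$):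 if Assumptions 1–5 and the step-size condition $\tau L_{\theta,K}<1$ hold, then $$\|u(n\tau)-u^n_{HIN}\|_{L^2}\le C(\varepsilon_{net}+\delta)\,\tau^\gamma\ln(1/\tau)\qquad\text{for all }n\ge1\text{ with }n\tau\le T.$$ In particular $C$ and $\tau_0$ depend only on the listed constants, not on $u$, $N$, $K$, the network or $\tau$. -/

import Mathlib

open MeasureTheory Set

noncomputable section

namespace HINLRI

/-! ### Function spaces on the torus of length 2π -/

instance fact_two_pi_pos : Fact (0 < 2 * Real.pi) := ⟨Real.two_pi_pos⟩

/-- The torus of length `2π`. -/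
abbrev Torus : Type := AddCircle (2 * Real.pi)

/-- Complex-valued square-integrable functions on the torus (normalised Haar measure). -/
abbrev L2T : Type := Lp ℂ 2 (AddCircle.haarAddCircle (T := 2 * Real.pi))

/-- The Fourier coefficient of an `L²` function. -/
def coeff (f : L2T) (k : ℤ) : ℂ := fourierCoeff (f : Torus → ℂ) k

theorem coeff_eq_repr (f : L2T) (k : ℤ) : coeff f k = fourierBasis.repr f k :=
  (fourierBasis_repr f k).symm

theorem coeff_add (f g : L2T) (k : ℤ) : coeff (f + g) k = coeff f k + coeff g k := by
  simp [coeff_eq_repr]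

theorem coeff_smul (c : ℂ) (f : L2T) (k : ℤ) : coeff (c • f) k = c * coeff f k := by
  simp [coeff_eq_repr]

theorem coeff_injective {f g : L2T} (h : ∀ k, coeff f k = coeff g k) : f = g := by
  apply fourierBasis.repr.injective
  ext k
  simpa [coeff_eq_repr] using h k

/-- The weight `⟨k⟩^γ = (1 + k²)^(γ/2)`. -/
def weight (γ : ℝ) (k : ℤ) : ℝ := (1 + (k : ℝ) ^ 2) ^ (γ / 2)

theorem weight_pos (γ : ℝ) (k : ℤ) : 0 < weight γ k := by
  unfold weight
  positivity

/-- The functions in `L²` whose weighted Fourier coefficients `⟨k⟩^γ f̂(k)` are square-summable. -/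
def sobolevSubmodule (γ : ℝ) : Submodule ℂ L2T where
  carrier := {f | Memℓp (fun k : ℤ => (weight γ k : ℂ) * coeff f k) 2}
  zero_mem' := by
    have h : (fun k : ℤ => (weight γ k : ℂ) * coeff 0 k) = 0 := by
      funext k
      simp [coeff_eq_repr]
    show Memℓp _ 2
    rw [h]
    exact zero_memℓp
  add_mem' := by
    intro f g hf hg
    have h : (fun k : ℤ => (weight γ k : ℂ) * coeff (f + g) k)
        = (fun k : ℤ => (weight γ k : ℂ) * coeff f k)
          + (fun k : ℤ => (weight γ k : ℂ) * coeff g k) := by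
      funext k
      simp [coeff_add, mul_add]
    show Memℓp _ 2
    rw [h]
    exact Memℓp.add hf hg
  smul_mem' := by
    intro c f hf
    have h : (fun k : ℤ => (weight γ k : ℂ) * coeff (c • f) k)
        = c • (fun k : ℤ => (weight γ k : ℂ) * coeff f k) := by
      funext k
      simp only [coeff_smul, Pi.smul_apply, smul_eq_mul]
      ring
    show Memℓp _ 2
    rw [h]
    exact Memℓp.const_smul hf c

/-- The Sobolev space `H^γ` of the torus (for `γ ≥ 0`), with its own norm, defined below. -/
def Hs (γ : ℝ) : Type := sobolevSubmodule γ

variable {γ : ℝ}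

instance : AddCommGroup (Hs γ) := inferInstanceAs (AddCommGroup (sobolevSubmodule γ))

instance : Module ℂ (Hs γ) := inferInstanceAs (Module ℂ (sobolevSubmodule γ))

/-- The inclusion of `H^γ` into `L²`. -/
def toL2 : Hs γ →ₗ[ℂ] L2T := (sobolevSubmodule γ).subtype

/-- The `k`-th Fourier coefficient of an element of `H^γ`. -/
def hcoeff (v : Hs γ) (k : ℤ) : ℂ := coeff (toL2 v) k

theorem hcoeff_injective {v w : Hs γ} (h : ∀ k, hcoeff v k = hcoeff w k) : v = w :=
  Subtype.ext (coeff_injective h)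

theorem hcoeff_add (v w : Hs γ) (k : ℤ) : hcoeff (v + w) k = hcoeff v k + hcoeff w k := by
  simp [hcoeff, coeff_add]

theorem hcoeff_smul (c : ℂ) (v : Hs γ) (k : ℤ) : hcoeff (c • v) k = c * hcoeff v k := by
  simp [hcoeff, coeff_smul]

/-- The weighted coefficient sequence `(⟨k⟩^γ v̂(k))` of `v ∈ H^γ`, as an element of `ℓ²`. -/
def weightedCoeff : Hs γ →ₗ[ℂ] lp (fun _ : ℤ => ℂ) 2 where
  toFun v := ⟨fun k => (weight γ k : ℂ) * hcoeff v k, v.2⟩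
  map_add' v w := by
    ext k
    show (weight γ k : ℂ) * hcoeff (v + w) k
      = (weight γ k : ℂ) * hcoeff v k + (weight γ k : ℂ) * hcoeff w k
    rw [hcoeff_add, mul_add]
  map_smul' c v := by
    ext k
    show (weight γ k : ℂ) * hcoeff (c • v) k = c * ((weight γ k : ℂ) * hcoeff v k)
    rw [hcoeff_smul]
    ring

theorem weightedCoeff_injective : Function.Injective (weightedCoeff (γ := γ)) := by
  intro v w h
  apply hcoeff_injective
  intro k
  have hk : (weight γ k : ℂ) * hcoeff v k = (weight γ k : ℂ) * hcoeff w k :=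
    congrFun (congrArg Subtype.val h) k
  exact mul_left_cancel₀ (Complex.ofReal_ne_zero.mpr (weight_pos γ k).ne') hk

/-- `H^γ` carries the norm `‖v‖² = ∑ (1 + k²)^γ |v̂(k)|²`. -/
instance : NormedAddCommGroup (Hs γ) :=
  NormedAddCommGroup.induced (Hs γ) (lp (fun _ : ℤ => ℂ) 2) weightedCoeff weightedCoeff_injective

theorem norm_sq_eq (v : Hs γ) :
    ‖v‖ ^ 2 = ∑' k : ℤ, (1 + (k : ℝ) ^ 2) ^ γ * ‖hcoeff v k‖ ^ 2 := by
  have h := lp.norm_rpow_eq_tsum (p := 2) (by norm_num) (weightedCoeff v)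
  have h2 : ‖v‖ = ‖weightedCoeff v‖ := rfl
  rw [h2]
  simp only [ENNReal.toReal_ofNat, Real.rpow_ofNat] at h
  rw [h]
  refine tsum_congr fun k => ?_
  show ‖(weight γ k : ℂ) * hcoeff v k‖ ^ 2 = _
  rw [norm_mul, mul_pow, Complex.norm_real, Real.norm_of_nonneg (weight_pos γ k).le, weight,
    ← Real.rpow_natCast, ← Real.rpow_mul (by positivity)]
  norm_num

/-- The exponential `x ↦ e^{ikx}` as an element of `H^γ`. -/
def expHs (k : ℤ) : Hs γ :=
  ⟨fourierLp 2 k, by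
    have hc : ∀ j : ℤ, coeff (fourierLp 2 k) j = if j = k then 1 else 0 := by
      intro j
      rw [coeff_eq_repr, ← coe_fourierBasis, HilbertBasis.repr_self]
      simp [lp.single_apply, Pi.single_apply]
    show Memℓp _ 2
    refine (memℓp_gen_iff (by norm_num)).2 ?_
    refine summable_of_ne_finset_zero (s := {k}) ?_
    intro j hj
    have : j ≠ k := by simpa using hj
    simp [hc, this]⟩

/-! ### Nonlinear dispersive equations `∂ₜu + i𝓛u = 𝓝(u)` -/

/-- A dispersive equation on the torus: `𝓛` has the real symbol `ω`, and
`𝓝(u) = ∑ⱼ mⱼ(D) (u^{aⱼ} ū^{bⱼ})` is a polynomial nonlinearity with Fourier multipliers `mⱼ(k)`.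
For instance `ω(k) = -k³`, `m(k) = ik/2`, `a = 2`, `b = 0` gives `𝓝(u) = ∂ₓ(u²)/2`,
and `ω(k) = k²`, `m(k) = c`, `a = 2`, `b = 1` gives `𝓝(u) = c|u|²u`. -/
structure DispersiveEq where
  ω : ℤ → ℝ
  numTerms : ℕ
  a : Fin numTerms → ℕ
  b : Fin numTerms → ℕ
  m : Fin numTerms → ℤ → ℂ

/-- The monomial `u^{aⱼ} ū^{bⱼ}`. -/
def DispersiveEq.monomial (E : DispersiveEq) (j : Fin E.numTerms) (v : Hs γ) : Torus → ℂ :=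
  fun x => (toL2 v : Torus → ℂ) x ^ E.a j * (starRingEnd ℂ) ((toL2 v : Torus → ℂ) x) ^ E.b j

/-- The `k`-th Fourier coefficient of `𝓝(v)`. -/
def DispersiveEq.nonlinCoeff (E : DispersiveEq) (v : Hs γ) (k : ℤ) : ℂ :=
  ∑ j, E.m j k * fourierCoeff (E.monomial j v) k

/-- The phase factor `e^{-itω(k)}`. -/
def DispersiveEq.phase (E : DispersiveEq) (t : ℝ) (k : ℤ) : ℂ :=
  Complex.exp (-Complex.I * (t * E.ω k : ℝ))

theorem DispersiveEq.norm_phase (E : DispersiveEq) (t : ℝ) (k : ℤ) : ‖E.phase t k‖ = 1 := by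
  rw [phase, show -Complex.I * ((t * E.ω k : ℝ) : ℂ) = ((-(t * E.ω k) : ℝ) : ℂ) * Complex.I by
    push_cast; ring]
  exact Complex.norm_exp_ofReal_mul_I _

theorem DispersiveEq.memℓp_phase (E : DispersiveEq) (t : ℝ) (v : Hs γ) :
    Memℓp (fun k => E.phase t k * hcoeff v k) 2 := by
  refine (memℓp_gen_iff (by norm_num)).2 ?_
  refine ((memℓp_gen_iff (by norm_num)).1 (fourierBasis.repr (toL2 v)).2).congr fun k => ?_
  rw [norm_mul, E.norm_phase, one_mul, hcoeff, coeff_eq_repr]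

/-- The function with Fourier coefficients `e^{-itω(k)} v̂(k)`, in `L²`. -/
def DispersiveEq.propagatorL2 (E : DispersiveEq) (t : ℝ) (v : Hs γ) : L2T :=
  fourierBasis.repr.symm ⟨_, E.memℓp_phase t v⟩

theorem DispersiveEq.coeff_propagatorL2 (E : DispersiveEq) (t : ℝ) (v : Hs γ) (k : ℤ) :
    coeff (E.propagatorL2 t v) k = E.phase t k * hcoeff v k := by
  rw [coeff_eq_repr, propagatorL2, LinearIsometryEquiv.apply_symm_apply]

/-- The linear propagator `𝓤(t) = exp(-it𝓛)` on `H^γ`: it multiplies the `k`-th Fourier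
coefficient by `e^{-itω(k)}`. -/
def DispersiveEq.propagator (E : DispersiveEq) (t : ℝ) (v : Hs γ) : Hs γ :=
  ⟨E.propagatorL2 t v, by
    show Memℓp (fun k => (weight γ k : ℂ) * coeff (E.propagatorL2 t v) k) 2
    refine (memℓp_gen_iff (by norm_num)).2 ?_
    refine ((memℓp_gen_iff (by norm_num)).1 (weightedCoeff v).2).congr fun k => ?_
    show ‖(weight γ k : ℂ) * hcoeff v k‖ ^ _ = _
    rw [E.coeff_propagatorL2, norm_mul, norm_mul, norm_mul, E.norm_phase, one_mul]⟩

theorem DispersiveEq.hcoeff_propagator (E : DispersiveEq) (t : ℝ) (v : Hs γ) (k : ℤ) :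
    hcoeff (E.propagator t v) k = E.phase t k * hcoeff v k :=
  E.coeff_propagatorL2 t v k

/-- The `k`-th Fourier coefficient of `∫₀ᵗ 𝓤(t-σ) 𝓝(u(σ)) dσ`. -/
def DispersiveEq.duhamelCoeff (E : DispersiveEq) (u : ℝ → Hs γ) (t : ℝ) (k : ℤ) : ℂ :=
  ∫ σ in (0 : ℝ)..t, E.phase (t - σ) k * E.nonlinCoeff (u σ) k

/-- `u ∈ C([0,T]; H^γ)` solves `∂ₜu + i𝓛u = 𝓝(u)` on `[0,T]` in Duhamel form, i.e.
`u(t) = 𝓤(t)u(0) + ∫₀ᵗ 𝓤(t-σ)𝓝(u(σ))dσ`, read off Fourier mode by Fourier mode. -/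
structure IsSolution (E : DispersiveEq) (T : ℝ) (u : ℝ → Hs γ) : Prop where
  continuousOn : ContinuousOn u (Icc 0 T)
  integrable_monomial : ∀ᵐ t ∂(volume.restrict (Icc 0 T)), ∀ j,
    Integrable (E.monomial j (u t)) AddCircle.haarAddCircle
  integrable_nonlin : ∀ k, IntervalIntegrable (fun t => E.nonlinCoeff (u t) k) volume 0 T
  duhamel : ∀ t ∈ Icc 0 T, ∀ k,
    hcoeff (u t) k = hcoeff (E.propagator t (u 0)) k + E.duhamelCoeff u t k

/-! ### The base integrator and its defect -/

/-- The base step `𝓗_phys(v) = 𝓤(τ)v + 𝓘_LRI(v,τ)` built from a base integrator `I = 𝓘_LRI`. -/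
def physStep (E : DispersiveEq) (I : ℝ → Hs γ → Hs γ) (τ : ℝ) (v : Hs γ) : Hs γ :=
  E.propagator τ v + I τ v

/-- The exact Duhamel increment `𝓘_exact = u(τ) - 𝓤(τ)u(0) = ∫₀^τ 𝓤(τ-σ)𝓝(u(σ))dσ` over a step
of length `τ`, for a solution `u` (see `hcoeff_exactIncrement`). -/
def exactIncrement (E : DispersiveEq) (u : ℝ → Hs γ) (τ : ℝ) : Hs γ :=
  u τ - E.propagator τ (u 0)

theorem hcoeff_exactIncrement {E : DispersiveEq} {u : ℝ → Hs γ} {τ : ℝ} (hτ : 0 ≤ τ)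
    (hu : IsSolution E τ u) (k : ℤ) : hcoeff (exactIncrement E u τ) k = E.duhamelCoeff u τ k := by
  have h := hu.duhamel τ ⟨hτ, le_rfl⟩ k
  have h2 := hcoeff_add (exactIncrement E u τ) (E.propagator τ (u 0)) k
  rw [exactIncrement, sub_add_cancel] at h2
  rw [h2] at h
  rw [exactIncrement]
  linear_combination h

/-- The defect `𝓔_defect = 𝓘_exact - 𝓘_LRI` at the initial state of the solution `u`. -/
def defect (E : DispersiveEq) (I : ℝ → Hs γ → Hs γ) (u : ℝ → Hs γ) (τ : ℝ) : Hs γ :=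
  exactIncrement E u τ - I τ (u 0)

/-- The base integrator converges at rate `τ^γ` in `L²` on `[0,T]`, along the exact solutions
with values in `K`, for step sizes `τ ≤ τ₁`. -/
def BaseConvergent (E : DispersiveEq) (I : ℝ → Hs γ → Hs γ) (K : Set (Hs γ)) (T τ₁ : ℝ) : Prop :=
  ∃ A : ℝ, ∀ τ ∈ Ioc 0 τ₁, ∀ u : ℝ → Hs γ, IsSolution E T u → (∀ t ∈ Icc 0 T, u t ∈ K) →
    ∀ n : ℕ, n * τ ≤ T → ‖toL2 (u (n * τ) - (physStep E I τ)^[n] (u 0))‖ ≤ A * τ ^ γ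

/-- The base step is Lipschitz-stable in `L²` with constant `1 + C₀τ` near `K`, for `τ ≤ τ₁`:
one of the two states is in `K`, the other one is any state in `H^γ` at `L²` distance
at most `ρ` from it. -/
def BaseStable (E : DispersiveEq) (I : ℝ → Hs γ → Hs γ) (K : Set (Hs γ)) (C₀ ρ τ₁ : ℝ) : Prop :=
  ∀ τ ∈ Ioc 0 τ₁, ∀ v ∈ K, ∀ w : Hs γ, ‖toL2 (v - w)‖ ≤ ρ →
    ‖toL2 (physStep E I τ v - physStep E I τ w)‖ ≤ (1 + C₀ * τ) * ‖toL2 (v - w)‖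

/-! ### The latent neural corrector -/

/-- Feed-forward networks `ℂⁿ → ℂᵖ` with Euclidean norms: each layer is an affine map (weight `W`,
bias `b`) followed by a scalar activation `s` applied to every component. -/
inductive Net (n : ℕ) : ℕ → Type where
  | input : Net n n
  | layer {q p : ℕ} (net : Net n q)
      (W : EuclideanSpace ℂ (Fin q) →L[ℂ] EuclideanSpace ℂ (Fin p))
      (b : EuclideanSpace ℂ (Fin p)) (s : ℂ → ℂ) : Net n p

/-- The function computed by a network. -/
def Net.eval {n : ℕ} : {p : ℕ} → Net n p → EuclideanSpace ℂ (Fin n) → EuclideanSpace ℂ (Fin p)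
  | _, .input, z => z
  | _, .layer net W b s, z => WithLp.toLp 2 fun i => s ((W (net.eval z) + b) i)

/-- The number of layers. -/
def Net.depth {n : ℕ} : {p : ℕ} → Net n p → ℕ
  | _, .input => 0
  | _, .layer net _ _ _ => net.depth + 1

/-- The product of the spectral norms of the weights of all layers. -/
def Net.weightProd {n : ℕ} : {p : ℕ} → Net n p → ℝ
  | _, .input => 1
  | _, .layer net W _ _ => net.weightProd * ‖W‖

/-- All activations are Lipschitz continuous with constant `κ`. -/
def Net.ActivationsLipschitz {n : ℕ} (κ : NNReal) : {p : ℕ} → Net n p → Prop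
  | _, .input => True
  | _, .layer net _ _ s => net.ActivationsLipschitz κ ∧ LipschitzWith κ s

/-- The `j`-th of the `N` Fourier modes `-⌊N/2⌋, …, ⌈N/2⌉ - 1` of the spectral grid. -/
def gridMode {N : ℕ} (j : Fin N) : ℤ := (j : ℤ) - (N : ℤ) / 2

/-- The restriction `𝐑 = Φ*`, applied to the `N` grid modes of a function. -/
def restriction {N d : ℕ} (Φ : Matrix (Fin N) (Fin d) ℂ) (v : Hs γ) : EuclideanSpace ℂ (Fin d) :=
  WithLp.toLp 2 (Φ.conjTranspose.mulVec fun j => hcoeff v (gridMode j))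

/-- The prolongation `𝐏 = Φ`, from latent vectors to trigonometric polynomials. -/
def prolongation {N d : ℕ} (Φ : Matrix (Fin N) (Fin d) ℂ) (z : EuclideanSpace ℂ (Fin d)) : Hs γ :=
  ∑ j, Φ.mulVec z.ofLp j • expHs (gridMode j)

/-- The neural correction `𝓗_neural = 𝐏 ∘ 𝓖_θ ∘ 𝐑`. -/
def neural {N d : ℕ} (Φ : Matrix (Fin N) (Fin d) ℂ) (G : Net d d) (v : Hs γ) : Hs γ :=
  prolongation Φ (G.eval (restriction Φ v))

/-- The HIN-LRI step `𝓢(v) = 𝓗_phys(v) + τ 𝓗_neural(v)`. -/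
def hinStep (E : DispersiveEq) (I : ℝ → Hs γ → Hs γ) {N d : ℕ} (Φ : Matrix (Fin N) (Fin d) ℂ)
    (G : Net d d) (τ : ℝ) (v : Hs γ) : Hs γ :=
  physStep E I τ v + (τ : ℂ) • neural Φ G v

/-- Training quality at step size `τ`: on the data set `K`, the correction `τ 𝓗_neural` matches the
defect in `L²` up to `(ε + δ) D(v,τ)`, where `D(v,τ) = C_D τ^{1+γ} ln(1/τ) ‖v‖³_{H^γ}`. -/
def TrainingQuality (E : DispersiveEq) (I : ℝ → Hs γ → Hs γ) (K : Set (Hs γ)) {N d : ℕ}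
    (Φ : Matrix (Fin N) (Fin d) ℂ) (G : Net d d) (C_D ε δ τ : ℝ) : Prop :=
  ∀ u : ℝ → Hs γ, IsSolution E τ u → u 0 ∈ K →
    ‖toL2 ((τ : ℂ) • neural Φ G (u 0) - defect E I u τ)‖
      ≤ (ε + δ) * (C_D * τ ^ (1 + γ) * Real.log (1 / τ) * ‖u 0‖ ^ 3)

end HINLRI

end

/-!
A one-step method that is stable and consistent along an exact trajectory converges. The network is
Lipschitz with constant at most `κ ^ depth * weightProd`, and an isometric `Φ` lets restriction and
prolongation add nothing to it, so the corrected step inherits from the base step the stability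
factor `1 + (C₀ + Λ) τ`. Its local error at `u(s)` is exactly the defect of the base integrator
minus the correction, for the solution restarted at time `s`; the training quality makes this
`O((ε + δ) τ^{1+γ} ln(1/τ))`. Stability is only available within distance `ρ` of the trajectory, so
the Gronwall argument is a bootstrap: `τ₀` is chosen such that the bound it yields is at most `ρ`,
and hence the iterates never leave the region where the recursion holds.
-/

namespace HINLRI

open Filter Topology
open scoped ENNReal NNReal Matrix Matrix.Norms.L2Operator

/-! ### Convergence of locally stable one-step methods -/

theorem discrete_gronwall_of_le {e : ℕ → ℝ} {b c ρ : ℝ} {n : ℕ} (he : ∀ k, 0 ≤ e k) (hb : 0 ≤ b)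
    (hc : 0 ≤ c) (hstep : ∀ k < n, e k ≤ ρ → e (k + 1) ≤ (1 + b) * e k + c)
    (hρ : (e 0 + n * c) * Real.exp (n * b) ≤ ρ) :
    e n ≤ (e 0 + n * c) * Real.exp (n * b) := by
  have gronwall : ∀ k ≤ n, (∀ i < k, e i ≤ ρ) → e k ≤ (e 0 + k * c) * Real.exp (k * b) := by
    intro k hkn hsmall
    have hstopped : ∀ i ≥ 0, e (min (i + 1) k) ≤ (1 + b) * e (min i k) + c := by
      intro i _
      rcases lt_or_ge i k with hik | hki
      · rw [min_eq_left hik.le, min_eq_left (Nat.succ_le_of_lt hik)]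
        exact hstep i (hik.trans_le hkn) (hsmall i hik)
      · rw [min_eq_right hki, min_eq_right (hki.trans i.le_succ)]
        linarith [mul_nonneg hb (he k)]
    simpa using discrete_gronwall (u := fun i => e (min i k)) (b := fun _ => c) (c := fun _ => b)
      (he _) hstopped (fun _ _ => hb) (fun _ _ => hc) k.zero_le
  have small : ∀ k ≤ n, e k ≤ ρ := by
    intro k
    induction k using Nat.strong_induction_on with
    | _ k ih =>
      intro hkn
      have h0 := he 0
      calc e k ≤ (e 0 + k * c) * Real.exp (k * b) :=
            gronwall k hkn fun i hik => ih i hik (hik.le.trans hkn)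
        _ ≤ (e 0 + n * c) * Real.exp (n * b) := by gcongr
        _ ≤ ρ := hρ
  exact gronwall n le_rfl fun i hi => small i hi.le

theorem dist_iterate_le_of_stable_of_consistent {X Y : Type*} [PseudoMetricSpace Y] {ι : X → Y}
    {S : X → X} {x : ℕ → X} {y : X} {b c ρ : ℝ} {n : ℕ} (hb : 0 ≤ b) (hc : 0 ≤ c)
    (hstable : ∀ k < n, ∀ z, dist (ι (x k)) (ι z) ≤ ρ →
      dist (ι (S (x k))) (ι (S z)) ≤ (1 + b) * dist (ι (x k)) (ι z))
    (hconsistent : ∀ k < n, dist (ι (x (k + 1))) (ι (S (x k))) ≤ c)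
    (hρ : (dist (ι (x 0)) (ι y) + n * c) * Real.exp (n * b) ≤ ρ) :
    dist (ι (x n)) (ι (S^[n] y)) ≤ (dist (ι (x 0)) (ι y) + n * c) * Real.exp (n * b) := by
  refine discrete_gronwall_of_le (e := fun k => dist (ι (x k)) (ι (S^[k] y)))
    (fun _ => dist_nonneg) hb hc (fun k hk hkρ => ?_) hρ
  rw [Function.iterate_succ_apply']
  exact ((dist_triangle _ (ι (S (x k))) _).trans
    (add_le_add (hconsistent k hk) (hstable k hk _ hkρ))).trans_eq (add_comm _ _)

theorem exists_forall_rpow_mul_log_inv_le {γ c : ℝ} (hγ : 0 < γ) (hc : 0 < c) :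
    ∃ τ₀ : ℝ, 0 < τ₀ ∧ ∀ τ ∈ Ioc 0 τ₀, τ ^ γ * Real.log (1 / τ) ≤ c := by
  have hlarge : ∀ᶠ τ in 𝓝[>] (0 : ℝ), -c < Real.log τ * τ ^ γ :=
    (tendsto_log_mul_rpow_nhdsGT_zero hγ).eventually_const_lt (neg_lt_zero.2 hc)
  obtain ⟨τ₀, hτ₀, hsub⟩ := mem_nhdsGT_iff_exists_Ioc_subset.1 hlarge
  refine ⟨τ₀, hτ₀, fun τ hτ => ?_⟩
  have hτc : -c < Real.log τ * τ ^ γ := hsub hτ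
  rw [one_div, Real.log_inv]
  linarith

variable {γ : ℝ}

/-! ### Restarting a solution -/

namespace DispersiveEq

theorem phase_add (E : DispersiveEq) (s t : ℝ) (k : ℤ) :
    E.phase (s + t) k = E.phase s k * E.phase t k := by
  rw [phase, phase, phase, ← Complex.exp_add]
  push_cast
  ring_nf

theorem continuous_phase (E : DispersiveEq) (k : ℤ) : Continuous fun t => E.phase t k := by
  unfold phase
  fun_prop

theorem duhamelCoeff_add (E : DispersiveEq) {u : ℝ → Hs γ} {s t : ℝ} {k : ℤ}
    (hs : IntervalIntegrable (fun σ => E.nonlinCoeff (u σ) k) volume 0 s)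
    (ht : IntervalIntegrable (fun σ => E.nonlinCoeff (u σ) k) volume s (s + t)) :
    E.duhamelCoeff u (s + t) k
      = E.phase t k * E.duhamelCoeff u s k + E.duhamelCoeff (fun r => u (s + r)) t k := by
  have hphase : ContinuousOn (fun σ => E.phase (s + t - σ) k) univ :=
    ((E.continuous_phase k).comp (continuous_sub_left (s + t))).continuousOn
  have hpast : ∫ σ in (0 : ℝ)..s, E.phase (s + t - σ) k * E.nonlinCoeff (u σ) k
      = E.phase t k * E.duhamelCoeff u s k := by
    rw [duhamelCoeff, ← intervalIntegral.integral_const_mul]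
    refine intervalIntegral.integral_congr fun σ _ => ?_
    simp only [← mul_assoc, ← phase_add]
    ring_nf
  have hrecent : ∫ σ in s..s + t, E.phase (s + t - σ) k * E.nonlinCoeff (u σ) k
      = E.duhamelCoeff (fun r => u (s + r)) t k := by
    simpa only [duhamelCoeff, add_zero, add_sub_add_left_eq_sub] using
      (intervalIntegral.integral_comp_add_left (a := 0) (b := t)
        (fun σ => E.phase (s + t - σ) k * E.nonlinCoeff (u σ) k) s).symm
  rw [← hpast, ← hrecent]
  exact (intervalIntegral.integral_add_adjacent_intervals
    (hs.continuousOn_mul (hphase.mono (subset_univ _)))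
    (ht.continuousOn_mul (hphase.mono (subset_univ _)))).symm

end DispersiveEq

namespace IsSolution

variable {E : DispersiveEq} {T : ℝ} {u : ℝ → Hs γ}

theorem intervalIntegrable_nonlinCoeff (hu : IsSolution E T u) (k : ℤ) {a b : ℝ}
    (ha : a ∈ Icc 0 T) (hb : b ∈ Icc 0 T) :
    IntervalIntegrable (fun t => E.nonlinCoeff (u t) k) volume a b :=
  (hu.integrable_nonlin k).mono_set (uIcc_subset_uIcc (Icc_subset_uIcc ha) (Icc_subset_uIcc hb))

theorem comp_const_add (hu : IsSolution E T u) {s r : ℝ} (hs : 0 ≤ s) (hr : 0 ≤ r)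
    (hsr : s + r ≤ T) : IsSolution E r fun t => u (s + t) := by
  have hmaps : MapsTo (fun t => s + t) (Icc 0 r) (Icc 0 T) := fun t ht =>
    ⟨add_nonneg hs ht.1, (add_le_add_right ht.2 s).trans hsr⟩
  have h0 : (0 : ℝ) ∈ Icc 0 T := ⟨le_rfl, (add_nonneg hs hr).trans hsr⟩
  have hsT : s ∈ Icc 0 T := ⟨hs, (le_add_of_nonneg_right hr).trans hsr⟩
  refine ⟨hu.continuousOn.comp (by fun_prop) hmaps, ?_, fun k => ?_, fun t ht k => ?_⟩
  · have hT := (ae_restrict_iff' measurableSet_Icc).1 hu.integrable_monomial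
    rw [ae_restrict_iff' measurableSet_Icc]
    filter_upwards [(measurePreserving_add_left volume s).quasiMeasurePreserving.ae hT]
      with t ht htr
    exact ht (hmaps htr)
  · simpa using
      (hu.intervalIntegrable_nonlinCoeff k hsT (hmaps (right_mem_Icc.2 hr))).comp_add_left s
  · have hat_add := hu.duhamel (s + t) (hmaps ht) k
    have hat := hu.duhamel s hsT k
    rw [E.hcoeff_propagator] at hat_add hat ⊢
    rw [add_zero, hat_add, hat, E.duhamelCoeff_add (hu.intervalIntegrable_nonlinCoeff k h0 hsT)
      (hu.intervalIntegrable_nonlinCoeff k hsT (hmaps ht)), E.phase_add]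
    ring

end IsSolution

/-! ### Lipschitz continuity of the neural correction -/

theorem lipschitzWith_toLp_comp {ι α β : Type*} [Fintype ι] [PseudoEMetricSpace α]
    [PseudoEMetricSpace β] (p : ℝ≥0∞) [Fact (1 ≤ p)] {κ : ℝ≥0} {s : α → β}
    (hs : LipschitzWith κ s) :
    LipschitzWith κ fun x : PiLp p (fun _ : ι => α) =>
      (WithLp.toLp p fun i => s (x i) : PiLp p fun _ : ι => β) := by
  intro x y
  rcases p.dichotomy with rfl | hp
  · simp only [PiLp.edist_eq_iSup, ENNReal.mul_iSup]
    exact iSup_mono fun i => hs (x i) (y i)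
  · have hp0 : 0 < p.toReal := zero_lt_one.trans_le hp
    rw [PiLp.edist_eq_sum hp0, PiLp.edist_eq_sum hp0]
    calc (∑ i, edist (s (x i)) (s (y i)) ^ p.toReal) ^ (1 / p.toReal)
        ≤ (∑ i, (κ * edist (x i) (y i)) ^ p.toReal) ^ (1 / p.toReal) := by
          gcongr with i
          exact hs (x i) (y i)
      _ = κ * (∑ i, edist (x i) (y i) ^ p.toReal) ^ (1 / p.toReal) := by
          simp only [ENNReal.mul_rpow_of_nonneg _ _ hp0.le, ← Finset.mul_sum]
          rw [ENNReal.mul_rpow_of_nonneg _ _ (one_div_nonneg.2 hp0.le), ← ENNReal.rpow_mul,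
            mul_one_div_cancel hp0.ne', ENNReal.rpow_one]

namespace Net

theorem weightProd_nonneg {n p : ℕ} (G : Net n p) : 0 ≤ G.weightProd := by
  induction G with
  | input => exact zero_le_one
  | layer net W _ _ ih => exact mul_nonneg ih (norm_nonneg W)

theorem norm_eval_sub_le {n p : ℕ} {κ : ℝ≥0} (G : Net n p) (hG : G.ActivationsLipschitz κ)
    (x y : EuclideanSpace ℂ (Fin n)) :
    ‖G.eval x - G.eval y‖ ≤ κ ^ G.depth * G.weightProd * ‖x - y‖ := by
  induction G with
  | input => simp [eval, depth, weightProd]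
  | layer net W b s ih =>
    calc ‖(layer net W b s).eval x - (layer net W b s).eval y‖
        ≤ κ * ‖W (net.eval x) + b - (W (net.eval y) + b)‖ :=
          (lipschitzWith_toLp_comp 2 hG.2).norm_sub_le (W (net.eval x) + b) (W (net.eval y) + b)
      _ = κ * ‖W (net.eval x - net.eval y)‖ := by rw [add_sub_add_right_eq_sub, map_sub]
      _ ≤ κ * (‖W‖ * (κ ^ net.depth * net.weightProd * ‖x - y‖)) := by
          gcongr
          exact W.le_opNorm_of_le (ih hG.1)
      _ = κ ^ (layer net W b s).depth * (layer net W b s).weightProd * ‖x - y‖ := by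
          rw [depth, weightProd]
          ring

end Net

theorem norm_sum_smul_of_orthonormal {𝕜 F ι : Type*} [RCLike 𝕜] [SeminormedAddCommGroup F]
    [InnerProductSpace 𝕜 F] [Fintype ι] {e : ι → F} (he : Orthonormal 𝕜 e) (c : ι → 𝕜) :
    ‖∑ i, c i • e i‖ = ‖WithLp.toLp 2 c‖ := by
  have hinner := he.inner_sum c c Finset.univ
  simp only [inner_self_eq_norm_sq_to_K, RCLike.conj_mul] at hinner
  rw [← sq_eq_sq₀ (norm_nonneg _) (norm_nonneg _), EuclideanSpace.norm_sq_eq]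
  exact_mod_cast hinner

theorem norm_le_one_of_conjTranspose_mul_self_eq_one {𝕜 m n : Type*} [RCLike 𝕜] [Fintype m]
    [Fintype n] [DecidableEq n] {A : Matrix m n 𝕜} (hA : Aᴴ * A = 1) : ‖A‖ ≤ 1 := by
  have hone : ‖(1 : Matrix n n 𝕜)‖ ≤ 1 := by
    rw [← Matrix.diagonal_one, Matrix.l2_opNorm_diagonal]
    exact (pi_norm_const_le 1).trans_eq norm_one
  rw [← hA, Matrix.l2_opNorm_conjTranspose_mul_self, ← sq] at hone
  exact (sq_le_one_iff₀ (norm_nonneg A)).1 hone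

theorem gridMode_injective {N : ℕ} : Function.Injective (gridMode (N := N)) := by
  intro i j hij
  unfold gridMode at hij
  omega

theorem orthonormal_fourierLp_gridMode (N : ℕ) :
    Orthonormal ℂ fun j : Fin N => (fourierLp 2 (gridMode j) : L2T) :=
  orthonormal_fourier.comp _ gridMode_injective

section Corrector

variable {N d : ℕ} (Φ : Matrix (Fin N) (Fin d) ℂ)

theorem restriction_sub (v w : Hs γ) :
    restriction Φ (v - w) = restriction Φ v - restriction Φ w := by
  rw [restriction, restriction, restriction, ← WithLp.toLp_sub, ← Matrix.mulVec_sub]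
  simp only [hcoeff, map_sub, coeff_eq_repr]
  rfl

theorem prolongation_sub (x y : EuclideanSpace ℂ (Fin d)) :
    (prolongation Φ (x - y) : Hs γ) = prolongation Φ x - prolongation Φ y := by
  simp only [prolongation, WithLp.ofLp_sub, Matrix.mulVec_sub, Pi.sub_apply, sub_smul,
    Finset.sum_sub_distrib]

theorem norm_toLp_hcoeff_gridMode_le (N : ℕ) (v : Hs γ) :
    ‖(WithLp.toLp 2 fun j : Fin N => hcoeff v (gridMode j) : EuclideanSpace ℂ (Fin N))‖
      ≤ ‖toL2 v‖ := by
  rw [← sq_le_sq₀ (norm_nonneg _) (norm_nonneg _), EuclideanSpace.norm_sq_eq]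
  simpa only [hcoeff, coeff_eq_repr, fourierBasis.repr_apply_apply, coe_fourierBasis] using
    (orthonormal_fourierLp_gridMode N).sum_inner_products_le (toL2 v) (s := Finset.univ)

theorem norm_restriction_le (v : Hs γ) : ‖restriction Φ v‖ ≤ ‖Φ‖ * ‖toL2 v‖ := by
  refine (Matrix.l2_opNorm_mulVec Φᴴ (WithLp.toLp 2 fun j => hcoeff v (gridMode j))).trans ?_
  rw [Matrix.l2_opNorm_conjTranspose]
  gcongr
  exact norm_toLp_hcoeff_gridMode_le N v

theorem norm_toL2_prolongation_le (z : EuclideanSpace ℂ (Fin d)) :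
    ‖toL2 (prolongation Φ z : Hs γ)‖ ≤ ‖Φ‖ * ‖z‖ := by
  have hsum : toL2 (prolongation Φ z : Hs γ)
      = ∑ j, (Φ *ᵥ z.ofLp) j • (fourierLp 2 (gridMode j) : L2T) := by
    simp only [prolongation, map_sum, map_smul]
    rfl
  rw [hsum, norm_sum_smul_of_orthonormal (orthonormal_fourierLp_gridMode N)]
  exact Matrix.l2_opNorm_mulVec Φ z

theorem norm_toL2_neural_sub_le {G : Net d d} {κ : ℝ≥0} (hG : G.ActivationsLipschitz κ)
    (v w : Hs γ) :
    ‖toL2 (neural Φ G v - neural Φ G w)‖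
      ≤ ‖Φ‖ ^ 2 * (κ ^ G.depth * G.weightProd) * ‖toL2 (v - w)‖ := by
  have hweight := G.weightProd_nonneg
  calc ‖toL2 (neural Φ G v - neural Φ G w)‖
      ≤ ‖Φ‖ * ‖G.eval (restriction Φ v) - G.eval (restriction Φ w)‖ := by
        rw [neural, neural, ← prolongation_sub]
        exact norm_toL2_prolongation_le Φ _
    _ ≤ ‖Φ‖ * (κ ^ G.depth * G.weightProd * ‖restriction Φ v - restriction Φ w‖) := by
        gcongr
        exact G.norm_eval_sub_le hG _ _
    _ ≤ ‖Φ‖ * (κ ^ G.depth * G.weightProd * (‖Φ‖ * ‖toL2 (v - w)‖)) := by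
        gcongr
        rw [← restriction_sub]
        exact norm_restriction_le Φ _
    _ = ‖Φ‖ ^ 2 * (κ ^ G.depth * G.weightProd) * ‖toL2 (v - w)‖ := by ring

theorem norm_toL2_neural_sub_le_of_isometric {Φ : Matrix (Fin N) (Fin d) ℂ} (hΦ : Φᴴ * Φ = 1)
    {G : Net d d} {κ : ℝ≥0} (hG : G.ActivationsLipschitz κ) (v w : Hs γ) :
    ‖toL2 (neural Φ G v - neural Φ G w)‖ ≤ κ ^ G.depth * G.weightProd * ‖toL2 (v - w)‖ := by
  have hweight := G.weightProd_nonneg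
  have hΦ1 : ‖Φ‖ ^ 2 ≤ 1 :=
    pow_le_one₀ (norm_nonneg Φ) (norm_le_one_of_conjTranspose_mul_self_eq_one hΦ)
  exact (norm_toL2_neural_sub_le Φ hG v w).trans
    (mul_le_mul_of_nonneg_right (mul_le_of_le_one_left (by positivity) hΦ1) (norm_nonneg _))

end Corrector

/-! ### The corrected integrator -/

/-- The base step corrected by `τ H`, for an arbitrary corrector `H` on `H^γ`; the HIN-LRI step is
the case `H = neural Φ G`. -/
noncomputable def correctedStep (E : DispersiveEq) (I : ℝ → Hs γ → Hs γ) (H : Hs γ → Hs γ)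
    (τ : ℝ) (v : Hs γ) : Hs γ :=
  physStep E I τ v + (τ : ℂ) • H v

section CorrectedStep

variable {E : DispersiveEq} {I : ℝ → Hs γ → Hs γ} {H : Hs γ → Hs γ} {τ : ℝ}

theorem sub_correctedStep_eq_defect_sub (u : ℝ → Hs γ) :
    u τ - correctedStep E I H τ (u 0) = defect E I u τ - (τ : ℂ) • H (u 0) := by
  simp only [correctedStep, physStep, defect, exactIncrement]
  abel

theorem norm_toL2_correctedStep_sub_le {C₀ Λ : ℝ} (hτ : 0 ≤ τ) {v w : Hs γ}
    (hphys : ‖toL2 (physStep E I τ v - physStep E I τ w)‖ ≤ (1 + C₀ * τ) * ‖toL2 (v - w)‖)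
    (hH : ‖toL2 (H v - H w)‖ ≤ Λ * ‖toL2 (v - w)‖) :
    ‖toL2 (correctedStep E I H τ v - correctedStep E I H τ w)‖
      ≤ (1 + (C₀ + Λ) * τ) * ‖toL2 (v - w)‖ := by
  have hsplit : toL2 (correctedStep E I H τ v - correctedStep E I H τ w)
      = toL2 (physStep E I τ v - physStep E I τ w) + (τ : ℂ) • toL2 (H v - H w) := by
    rw [correctedStep, correctedStep, add_sub_add_comm, ← smul_sub, map_add, map_smul]
  calc ‖toL2 (correctedStep E I H τ v - correctedStep E I H τ w)‖
      ≤ ‖toL2 (physStep E I τ v - physStep E I τ w)‖ + τ * ‖toL2 (H v - H w)‖ := by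
        rw [hsplit]
        refine (norm_add_le _ _).trans_eq ?_
        rw [norm_smul, Complex.norm_of_nonneg hτ]
    _ ≤ (1 + C₀ * τ) * ‖toL2 (v - w)‖ + τ * (Λ * ‖toL2 (v - w)‖) := by gcongr
    _ = (1 + (C₀ + Λ) * τ) * ‖toL2 (v - w)‖ := by ring

theorem norm_toL2_sub_correctedStep_iterate_le {K : Set (Hs γ)} {C₀ Λ ρ τ₁ T η : ℝ}
    {u : ℝ → Hs γ} {n : ℕ} (hstable : BaseStable E I K C₀ ρ τ₁) (hτ : τ ∈ Ioc 0 τ₁)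
    (hH : ∀ v w, ‖toL2 (H v - H w)‖ ≤ Λ * ‖toL2 (v - w)‖) (hL : 0 ≤ C₀ + Λ)
    (hη : 0 ≤ η) (hdefect : ∀ w : ℝ → Hs γ, IsSolution E τ w → w 0 ∈ K →
      ‖toL2 ((τ : ℂ) • H (w 0) - defect E I w τ)‖ ≤ τ * η)
    (hu : IsSolution E T u) (huK : ∀ t ∈ Icc 0 T, u t ∈ K)
    (hρ : T * η * Real.exp ((C₀ + Λ) * T) ≤ ρ) (hn : n * τ ≤ T) :
    ‖toL2 (u (n * τ) - (correctedStep E I H τ)^[n] (u 0))‖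
      ≤ T * η * Real.exp ((C₀ + Λ) * T) := by
  have hτ0 : 0 ≤ τ := hτ.1.le
  have hsucc : ∀ k < n, k * τ + τ ≤ T := fun k hk =>
    calc k * τ + τ = (k + 1 : ℕ) * τ := by push_cast; ring
      _ ≤ n * τ := by gcongr; exact hk
      _ ≤ T := hn
  have hmem : ∀ k < n, u (k * τ) ∈ K := fun k hk =>
    huK _ ⟨by positivity, by linarith [hsucc k hk]⟩
  have hlocal : ∀ k < n, ‖toL2 (u (k * τ + τ) - correctedStep E I H τ (u (k * τ)))‖ ≤ τ * η := by
    intro k hk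
    have hrestart := hu.comp_const_add (by positivity) hτ0 (hsucc k hk)
    have hidentity := sub_correctedStep_eq_defect_sub (E := E) (I := I) (H := H) (τ := τ)
      fun t => u (k * τ + t)
    have hbound := hdefect _ hrestart (by simpa using hmem k hk)
    rwa [← norm_neg, ← map_neg, neg_sub, ← hidentity, add_zero] at hbound
  have hT : (0 + n * (τ * η)) * Real.exp (n * ((C₀ + Λ) * τ))
      ≤ T * η * Real.exp ((C₀ + Λ) * T) := by
    rw [zero_add, ← mul_assoc, mul_left_comm]
    gcongr
    exact mul_nonneg (le_trans (by positivity) hn) hη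
  have hglobal := dist_iterate_le_of_stable_of_consistent (ι := toL2)
    (S := correctedStep E I H τ) (x := fun k => u (k * τ)) (y := u 0) (b := (C₀ + Λ) * τ)
    (c := τ * η) (ρ := ρ) (n := n) (by positivity) (by positivity)
    (fun k hk z hz => by
      simp only [dist_eq_norm, ← map_sub] at hz ⊢
      exact norm_toL2_correctedStep_sub_le hτ0 (hstable τ hτ _ (hmem k hk) z hz) (hH _ _))
    (fun k hk => by
      rw [dist_eq_norm, ← map_sub, Nat.cast_succ, add_one_mul]
      exact hlocal k hk)
    (by simpa using hT.trans hρ)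
  rw [map_sub, ← dist_eq_norm]
  simpa using hglobal.trans (by simpa using hT)

end CorrectedStep

end HINLRI

open HINLRI in
theorem mainTheorem1_general (γ T R C₀ C_D Λ : ℝ) (hγ : 0 < γ) (hT : 0 < T) (hC₀ : 0 ≤ C₀)
    (hC_D : 0 ≤ C_D) :
    ∃ C : ℝ, 0 < C ∧ ∀ ρ τ₁ B : ℝ, 0 < ρ → 0 < τ₁ → ∃ τ₀ : ℝ, 0 < τ₀ ∧
      ∀ (E : DispersiveEq) (I : ℝ → Hs γ → Hs γ) (K : Set (Hs γ)),
        (∀ v ∈ K, ‖v‖ ≤ R) → BaseStable E I K C₀ ρ τ₁ →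
      ∀ u : ℝ → Hs γ, IsSolution E T u → (∀ t ∈ Icc 0 T, u t ∈ K) →
      ∀ ε ∈ Icc 0 B, ∀ τ ∈ Ioc 0 τ₀, ∀ H : Hs γ → Hs γ,
        (∀ v w, ‖toL2 (H v - H w)‖ ≤ Λ * ‖toL2 (v - w)‖) →
        (∀ w : ℝ → Hs γ, IsSolution E τ w → w 0 ∈ K →
          ‖toL2 ((τ : ℂ) • H (w 0) - defect E I w τ)‖
            ≤ ε * (C_D * τ ^ (1 + γ) * Real.log (1 / τ) * ‖w 0‖ ^ 3)) →
      ∀ n : ℕ, n * τ ≤ T →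
        ‖toL2 (u (n * τ) - (correctedStep E I H τ)^[n] (u 0))‖
          ≤ C * ε * τ ^ γ * Real.log (1 / τ) := by
  set C : ℝ := T * (C_D * |R| ^ 3) * Real.exp ((C₀ + |Λ|) * T) + 1 with hC
  have hC0 : 0 < C := by positivity
  refine ⟨C, hC0, fun ρ τ₁ B hρ hτ₁ => ?_⟩
  obtain ⟨τ₂, hτ₂, hsmall⟩ :=
    exists_forall_rpow_mul_log_inv_le hγ (c := ρ / (C * (|B| + 1))) (by positivity)
  refine ⟨min (min τ₁ τ₂) 1, by positivity, ?_⟩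
  intro E I K hKR hstable u hu huK ε ⟨hε0, hεB⟩ τ ⟨hτ0, hτ⟩ H hH hdefect n hn
  obtain ⟨⟨hτ₁', hτ₂'⟩, hτ1⟩ : (τ ≤ τ₁ ∧ τ ≤ τ₂) ∧ τ ≤ 1 := by simpa only [le_min_iff] using hτ
  have hlog : 0 ≤ Real.log (1 / τ) := Real.log_nonneg ((one_le_div hτ0).2 hτ1)
  set q : ℝ := τ ^ γ * Real.log (1 / τ) with hq
  have hq0 : 0 ≤ q := by positivity
  have hlocal : ∀ w : ℝ → Hs γ, IsSolution E τ w → w 0 ∈ K →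
      ‖toL2 ((τ : ℂ) • H (w 0) - defect E I w τ)‖ ≤ τ * (C_D * |R| ^ 3 * (ε * q)) := by
    intro w hw hwK
    have hR : ‖w 0‖ ≤ |R| := (hKR _ hwK).trans (le_abs_self R)
    calc _ ≤ ε * (C_D * τ ^ (1 + γ) * Real.log (1 / τ) * ‖w 0‖ ^ 3) := hdefect w hw hwK
      _ ≤ ε * (C_D * τ ^ (1 + γ) * Real.log (1 / τ) * |R| ^ 3) := by gcongr
      _ = τ * (C_D * |R| ^ 3 * (ε * q)) := by
        rw [hq, Real.rpow_add hτ0, Real.rpow_one]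
        ring
  have hglobal : T * (C_D * |R| ^ 3 * (ε * q)) * Real.exp ((C₀ + |Λ|) * T) ≤ C * (ε * q) := by
    rw [hC]
    linarith [mul_nonneg hε0 hq0]
  have hwithin : C * (ε * q) ≤ ρ :=
    calc C * (ε * q) ≤ C * ((|B| + 1) * (ρ / (C * (|B| + 1)))) := by
          gcongr
          · linarith [le_abs_self B]
          · exact hsmall τ ⟨hτ0, hτ₂'⟩
      _ = ρ := by field_simp
  calc _ ≤ T * (C_D * |R| ^ 3 * (ε * q)) * Real.exp ((C₀ + |Λ|) * T) :=
        norm_toL2_sub_correctedStep_iterate_le hstable ⟨hτ0, hτ₁'⟩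
          (fun v w => (hH v w).trans (by gcongr; exact le_abs_self Λ)) (by positivity)
          (by positivity) hlocal hu huK (hglobal.trans hwithin) hn
    _ ≤ C * (ε * q) := hglobal
    _ = C * ε * τ ^ γ * Real.log (1 / τ) := by rw [hq]; ring

theorem mainTheorem1 (γ T R C₀ C_D Λ : ℝ) (hγ : γ ∈ Set.Ioc (0 : ℝ) 1) (hT : 0 < T)
    (hC₀ : 0 ≤ C₀) (hC_D : 0 ≤ C_D) :
    ∃ C : ℝ, 0 < C ∧ ∀ ρ τ₁ B : ℝ, 0 < ρ → 0 < τ₁ → ∃ τ₀ : ℝ, 0 < τ₀ ∧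
      ∀ (E : HINLRI.DispersiveEq) (I : ℝ → HINLRI.Hs γ → HINLRI.Hs γ) (K : Set (HINLRI.Hs γ)),
        IsCompact K → (∀ v ∈ K, ‖v‖ ≤ R) →
        HINLRI.BaseConvergent E I K T τ₁ → HINLRI.BaseStable E I K C₀ ρ τ₁ →
      ∀ u : ℝ → HINLRI.Hs γ, HINLRI.IsSolution E T u → HINLRI.hcoeff (u 0) 0 = 0 →
        (∀ t ∈ Set.Icc 0 T, u t ∈ K) →
      ∀ ε δ : ℝ, ε ∈ Set.Icc (0 : ℝ) 1 → 0 ≤ δ → ε + δ ≤ B →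
      ∀ τ ∈ Set.Ioc 0 τ₀,
      ∀ (N d : ℕ) (Φ : Matrix (Fin N) (Fin d) ℂ) (G : HINLRI.Net d d) (κ : NNReal),
        Φ.conjTranspose * Φ = 1 →
        G.ActivationsLipschitz κ → (κ : ℝ) ^ G.depth * G.weightProd ≤ Λ →
        τ * G.weightProd < 1 →
        HINLRI.TrainingQuality E I K Φ G C_D ε δ τ →
      ∀ n : ℕ, 1 ≤ n → n * τ ≤ T →
        ‖HINLRI.toL2 (u (n * τ) - (HINLRI.hinStep E I Φ G τ)^[n] (u 0))‖
          ≤ C * (ε + δ) * τ ^ γ * Real.log (1 / τ) := by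
  obtain ⟨C, hC, hconv⟩ := mainTheorem1_general γ T R C₀ C_D Λ hγ.1 hT hC₀ hC_D
  refine ⟨C, hC, fun ρ τ₁ B hρ hτ₁ => (hconv ρ τ₁ B hρ hτ₁).imp fun τ₀ ⟨hτ₀, herror⟩ => ⟨hτ₀, ?_⟩⟩
  intro E I K _ hK _ hstable u hu _ huK ε δ hε hδ hB τ hτ N d Φ G κ hΦ hG hΛ _ hquality n _
  exact herror E I K hK hstable u hu huK (ε + δ) ⟨add_nonneg hε.1 hδ, hB⟩ τ hτ (HINLRI.neural Φ G)
    (fun v w => (HINLRI.norm_toL2_neural_sub_le_of_isometric hΦ hG v w).trans (by gcongr))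
    hquality n
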